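/- **Model.** For integers $B\ge 1$, $T\ge 0$, a *receiver with parameters $(B,T)$* sees a channel that, for some starting time $j\ge 0$ (not known in advance), erases the channel packets $\mathbf{x}[j],\dots,\mathbf{x}[j+B-1]$ and delivers all others. A *code* consists of a finite source alphabet $\mathcal S$ with a distribution $p_{\mathbf s}$, a finite channel alphabet $\mathcal X$ with $|\mathcal X|\ge 2$, and causal encoding functions $\mathbf{x}[t]=f_t(\mathbf{s}[0],\dots,\mathbf{s}[t])\in\mathcal X$, $t\ge 0$, where the source packets $\mathbf{s}[t]$ are i.i.d. with law $p_{\mathbf s}$. It *serves* the receiver $(B,T)$ if there are decoding functions $\gamma_t$ such that, for every $j\ge 0$ and every $t\ge 0$, the estimate $\hat{\mathbf s}[t]=\gamma_t(\mathbf{y}[0],\dots,\mathbf{y}[t+T])$ computed from the channel outputs satisfies $\Pr(\hat{\mathbf s}[t]\ne \mathbf s[t])=0$. The rate of the code is $H(\mathbf s)/\log_2|\mathcal X|$. The multicast streaming capacity $C(B_1,T_1,B_2,T_2)$ is the maximum of the rates of codes that serve both the receiver $(B_1,T_1)$ and the receiver $(B_2,T_2)$. **Theorem.** Let $B_1,B_2\ge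 1$ and $T_1,T_2\ge 0$ be integers with $B_2>B_1$, and suppose that $T_1\ge B_2$ or $T_2\ge B_1+B_2$. Put $\alpha=B_2/B_1$ and, for $i=1,2$, let $C_i=\frac{T_i}{T_i+B_i}$ if $T_i\ge B_i$ and $C_i=0$ if $T_i<B_i$ (the single-user capacity of user $i$). Then the maximum defining the capacity is attained, and $$C(B_1,T_1,B_2,T_2)=\begin{cases} C_1, & T_2\ge \alpha T_1+B_1,\\[2pt] \dfrac{T_2-B_1}{T_2-B_1+B_2}, & T_1+B_1\le T_2\le \alpha T_1+B_1,\\[6pt] \dfrac{T_1}{T_1+B_2}, & T_1\le T_2\le T_1+B_1,\\[6pt] C_2, & T_2\le T_1.\end{cases}$$ -/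

import Mathlib

namespace Streaming

/-- A causal encoder: `f t` maps the source packets `s[0], …, s[t]` to the channel packet `x[t]`. -/
abbrev Encoder (S X : Type) : Type := (t : ℕ) → (Fin (t + 1) → S) → X

/-- The stream of channel packets `x[t] = f_t (s[0], …, s[t])`. -/
def channelInput {S X : Type} (f : Encoder S X) (s : ℕ → S) (t : ℕ) : X :=
  f t (fun k => s k)

/-- Output of the channel that erases the packets at times `j, …, j + B - 1` (an erased packet is
`none`) and delivers every other packet unchanged. -/
def burstOutput {X : Type} (B j : ℕ) (x : ℕ → X) (t : ℕ) : Option X :=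
  if j ≤ t ∧ t < j + B then none else some (x t)

/-- A family of decoding functions with delay `T`: the packet with index `t` is estimated from the
channel outputs `y[0], …, y[t + T]`. -/
abbrev Decoder (S X : Type) (T : ℕ) : Type :=
  (t : ℕ) → (Fin (t + T + 1) → Option X) → S

/-- The estimate of the source packet with index `t`. -/
def estimate {S X : Type} {T : ℕ} (γ : Decoder S X T) (y : ℕ → Option X) (t : ℕ) : S :=
  γ t (fun k => y k)

/-- The law of the i.i.d. source stream whose packets all have the distribution `p`. -/
noncomputable def sourceLaw {S : Type} (p : PMF S) : @MeasureTheory.Measure (ℕ → S)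
    (@MeasurableSpace.pi ℕ (fun _ => S) (fun _ => ⊤)) :=
  letI : MeasurableSpace S := ⊤
  MeasureTheory.Measure.infinitePi (fun _ : ℕ => p.toMeasure)

/-- The encoder `f` serves a receiver with parameters `(B, T)`: there are decoding functions with
delay `T` that, wherever the erasure burst of length `B` starts, recover every source packet with
error probability zero. -/
def Serves {S X : Type} (p : PMF S) (f : Encoder S X) (B T : ℕ) : Prop :=
  ∃ γ : Decoder S X T, ∀ j t : ℕ,
    sourceLaw p {s | s t ≠ estimate γ (burstOutput B j (channelInput f s)) t} = 0

/-- Shannon entropy, in bits, of a distribution on a finite alphabet. -/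
noncomputable def entropyBits {S : Type} [Fintype S] (p : PMF S) : ℝ :=
  ∑ a : S, Real.negMulLog (p a).toReal / Real.log 2

/-- The rates `H(s) / log₂ |X|` of the codes, over arbitrary finite alphabets, that simultaneously
serve a receiver with parameters `(B₁, T₁)` and a receiver with parameters `(B₂, T₂)`. -/
def achievableRates (B₁ T₁ B₂ T₂ : ℕ) : Set ℝ :=
  {R | ∃ (S X : Type) (_ : Fintype S) (_ : Fintype X) (p : PMF S) (f : Encoder S X),
    2 ≤ Fintype.card X ∧ Serves p f B₁ T₁ ∧ Serves p f B₂ T₂ ∧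
    R = entropyBits p / Real.logb 2 (Fintype.card X)}

/-- `C` is the multicast streaming capacity, i.e. the maximum achievable rate. -/
def IsMulticastCapacity (B₁ T₁ B₂ T₂ : ℕ) (C : ℝ) : Prop :=
  IsGreatest (achievableRates B₁ T₁ B₂ T₂) C

/-- The single-user capacity: `T / (T + B)` if `T ≥ B`, and `0` if `T < B`. -/
noncomputable def singleUserCapacity (B T : ℕ) : ℝ :=
  if B ≤ T then (T : ℝ) / (T + B) else 0

end Streaming

namespace Streaming

open MeasureTheory Finset

/-! Zero-error decoding over an erasure channel is combinatorial: `Separates` on all streams implies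
`Serves`, and `Serves` implies `Separates` on the support of the source.

Converse: let the channel erase `B₂` slots, deliver `W`, and repeat. If `T₂ ≤ W + B₁`, receiver 2
recovers the first `B₂ - B₁` packets of each burst before the next one begins. Re-encoding them
leaves a burst of length `B₁`, which receiver 1 resolves when `T₁ ≤ W`. So the delivered packets
determine the source and the rate is at most `W / (W + B₂)`. The values `W = T₂ - B₁` and `W = T₁`
give the two middle regimes; the same argument with one receiver gives `C₁` and `C₂`
(`card_log_le_of_periodic`, `Separates.eq_of_periodic_pair`).

Achievability: to `M` source symbols append `N` parity symbols, each the sum of two single-user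
parities. The first code corrects bursts of length `N * b` with delay `M * b`. The second, with step
`g` and the symbols in reversed order, is postponed by `(M + N) * b`. After a short burst the second
code refers only to the time before the burst until the deadline has passed. After a burst of length
`N * (b + g)`, the first code recovers the last `N * b` slots, and the second code is left with a
burst of length `N * g` (`separates_short`, `separates_long`). Grouping packets into blocks adapts
the parameters to regimes one and two. In regimes three and four a single-user code for bursts of
length `B₂` and the smaller delay suffices, or a constant code when the capacity is zero. -/

/-! ### Zero-error decoding as separation of streams -/

/-- Any two streams with packets in `A` whose channel packets agree up to time `t + T` outside some
burst of length `B` have the same source packet at time `t`. -/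
def Separates {S X : Type} (f : Encoder S X) (A : Set S) (B T : ℕ) : Prop :=
  ∀ (j t : ℕ) (s s' : ℕ → S), (∀ i, s i ∈ A) → (∀ i, s' i ∈ A) →
    (∀ k ≤ t + T, (j ≤ k → j + B ≤ k) → channelInput f s k = channelInput f s' k) → s t = s' t

theorem channelInput_congr {S X : Type} (f : Encoder S X) {s s' : ℕ → S} {k : ℕ}
    (h : ∀ i ≤ k, s i = s' i) : channelInput f s k = channelInput f s' k := by
  unfold channelInput
  congr 1
  funext i
  exact h i (by omega)

theorem Separates.mono {S X : Type} {f : Encoder S X} {A : Set S} {B T B' T' : ℕ}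
    (h : Separates f A B T) (hB : B' ≤ B) (hT : T ≤ T') : Separates f A B' T' := by
  intro j t s s' hs hs' hx
  exact h j t s s' hs hs' fun k hk hj => hx k (by omega) (fun h => by have := hj h; omega)

/-- The decoder picks any stream consistent with what it received. The burst position assumed for
that stream need not be the true one, since the delivered packets agree anyway. -/
theorem serves_of_separates {S X : Type} (p : PMF S) {f : Encoder S X} {B T : ℕ}
    (h : Separates f Set.univ B T) : Serves p f B T := by
  classical
  obtain ⟨a, -⟩ := p.support_nonempty
  refine ⟨fun t y => if hy : ∃ s : ℕ → S, ∃ j : ℕ, ∀ k : Fin (t + T + 1),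
    burstOutput B j (channelInput f s) k = y k then hy.choose t else a, fun j t => ?_⟩
  convert measure_empty (μ := sourceLaw p)
  ext s
  simp only [Set.mem_ofPred_eq, Set.mem_empty_iff_false, iff_false, not_not]
  have hy : ∃ s' : ℕ → S, ∃ j' : ℕ, ∀ k : Fin (t + T + 1),
      burstOutput B j' (channelInput f s') k = burstOutput B j (channelInput f s) k :=
    ⟨s, j, fun _ => rfl⟩
  simp only [estimate]
  rw [dif_pos hy]
  obtain ⟨j', hj'⟩ := hy.choose_spec
  refine h j t _ _ (fun _ => trivial) (fun _ => trivial) fun k hk hjk => ?_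
  have h1 := hj' ⟨k, by omega⟩
  simp only [burstOutput] at h1
  rw [if_neg (by omega : ¬(j ≤ k ∧ k < j + B))] at h1
  split_ifs at h1
  exact (Option.some_injective _ h1).symm

theorem sourceLaw_cylinder_ne_zero {S : Type} (p : PMF S) {s : ℕ → S}
    (hs : ∀ i, s i ∈ p.support) (n : ℕ) :
    sourceLaw p (Set.pi (range n) fun i => {s i}) ≠ 0 := by
  let _ : MeasurableSpace S := ⊤
  have : sourceLaw p = Measure.infinitePi (fun _ : ℕ => p.toMeasure) := rfl
  rw [this, Measure.infinitePi_pi _ (fun _ _ => MeasurableSpace.measurableSet_top)]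
  refine prod_ne_zero_iff.mpr fun i _ => ?_
  rw [PMF.toMeasure_apply_singleton _ _ (MeasurableSpace.measurableSet_top)]
  exact (p.mem_support_iff _).mp (hs i)

/-- The estimate depends on a finite prefix, and a prefix with letters in the support has positive
probability. Hence decoding is correct for every such stream, not just almost surely. -/
theorem Serves.separates {S X : Type} {p : PMF S} {f : Encoder S X} {B T : ℕ}
    (h : Serves p f B T) : Separates f p.support B T := by
  obtain ⟨γ, hγ⟩ := h
  have key : ∀ (j t : ℕ) (s : ℕ → S), (∀ i, s i ∈ p.support) →
      s t = estimate γ (burstOutput B j (channelInput f s)) t := by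
    intro j t s hs
    by_contra hne
    refine sourceLaw_cylinder_ne_zero p hs (t + T + 1) (measure_mono_null ?_ (hγ j t))
    intro s' hs'
    have hs'' : ∀ i ≤ t + T, s' i = s i := fun i hi => by
      simpa using hs' i (by simpa using Nat.lt_succ_of_le hi)
    simp only [Set.mem_ofPred_eq]
    rw [hs'' t (by omega)]
    have hest : estimate γ (burstOutput B j (channelInput f s')) t =
        estimate γ (burstOutput B j (channelInput f s)) t := by
      unfold estimate
      congr 1
      funext k
      unfold burstOutput
      rw [channelInput_congr f fun i hi => hs'' i (by omega)]
    rwa [hest]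
  intro j t s s' hs hs' hx
  rw [key j t s hs, key j t s' hs']
  unfold estimate
  congr 1
  funext k
  unfold burstOutput
  split_ifs with hk
  · rfl
  · rw [hx k (by omega) (by omega)]

/-! ### Converse: periodic erasures -/

/-- Jensen's inequality for the concave `Real.negMulLog`, with equal weights on the support. -/
theorem entropyBits_le {S : Type} [Fintype S] [DecidableEq S] (p : PMF S) [Fintype p.support] :
    entropyBits p ≤ Real.log (Fintype.card p.support) / Real.log 2 := by
  unfold entropyBits
  rw [← sum_div]
  gcongr
  have hsum : ∑ a : S, (p a).toReal = 1 := by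
    rw [← ENNReal.toReal_sum (fun a _ => p.apply_ne_top a), ← tsum_fintype (L := .unconditional S),
      p.tsum_coe]
    rfl
  set A : Finset S := p.support.toFinset with hA
  have hz : ∀ a ∉ A, p a = 0 := by
    intro a ha
    simpa [hA] using ha
  have hcard : Fintype.card p.support = #A := by rw [hA, Set.toFinset_card]
  have hne : A.Nonempty := by
    obtain ⟨a, ha⟩ := p.support_nonempty
    exact ⟨a, by simpa [hA] using ha⟩
  have hpos : (0 : ℝ) < #A := by exact_mod_cast hne.card_pos
  have h1 : ∑ a ∈ A, (p a).toReal = 1 := by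
    rw [← hsum]
    exact sum_subset (subset_univ _) fun a _ ha => by simp [hz a ha]
  have h2 : ∑ a : S, Real.negMulLog (p a).toReal = ∑ a ∈ A, Real.negMulLog (p a).toReal := by
    symm
    exact sum_subset (subset_univ _) fun a _ ha => by simp [hz a ha]
  rw [h2, hcard]
  have hJ := Real.concaveOn_negMulLog.le_map_sum (t := A) (w := fun _ => (1 : ℝ) / #A)
    (p := fun a => (p a).toReal) (fun _ _ => by positivity)
    (by rw [sum_const, nsmul_eq_mul]; field_simp) (fun a _ => ENNReal.toReal_nonneg)
  simp only [smul_eq_mul, ← mul_sum, h1, mul_one] at hJ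
  rw [Real.negMulLog, Real.log_div one_ne_zero hpos.ne', Real.log_one] at hJ
  field_simp at hJ
  linarith

/-- If the packets sent in the last `W` slots of every period of length `B + W` determine the
stream up to a bounded delay, then the rate is at most `W / (B + W)`. -/
theorem card_log_le_of_periodic {S X : Type} [Fintype X] (f : Encoder S X) (A : Set S)
    [Fintype A] (hA : A.Nonempty) (B W T : ℕ)
    (h : ∀ (K : ℕ) (s s' : ℕ → S), (∀ i, s i ∈ A) → (∀ i, s' i ∈ A) →
      (∀ k < K * (B + W), B ≤ k % (B + W) → channelInput f s k = channelInput f s' k) →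
      ∀ t, t + T < K * (B + W) → s t = s' t) :
    ((B : ℝ) + W) * Real.log (Fintype.card A) ≤ W * Real.log (Fintype.card X) := by
  obtain ⟨a, ha⟩ := hA
  -- The `K * W` delivered packets fix all but the last `T` source packets; this boundary loss
  -- vanishes in the rate as `K` grows.
  have hcount : ∀ K, Fintype.card A ^ (K * (B + W) - T) ≤ Fintype.card X ^ (K * W) := by
    intro K
    let ext : (Fin (K * (B + W) - T) → A) → ℕ → S := fun w i =>
      if hi : i < K * (B + W) - T then w ⟨i, hi⟩ else a
    have hext : ∀ w i, ext w i ∈ A := by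
      intro w i
      simp only [ext]
      split_ifs
      · exact Subtype.property _
      · exact ha
    let Φ : (Fin (K * (B + W) - T) → A) → (Fin K × Fin W → X) := fun w k =>
      channelInput f (ext w) (k.1 * (B + W) + (B + k.2))
    have hΦ : Function.Injective Φ := by
      intro w w' hw
      have hx : ∀ t, t + T < K * (B + W) → ext w t = ext w' t := by
        refine h K _ _ (hext w) (hext w') fun k hk hkB => ?_
        have hP : 0 < B + W := Nat.pos_of_ne_zero fun h0 => by simp [h0] at hk
        have h1 : k / (B + W) < K := Nat.div_lt_of_lt_mul (by rwa [mul_comm])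
        have h2 : k % (B + W) - B < W := by
          have := Nat.mod_lt k hP
          omega
        have h3 := congrFun hw (⟨_, h1⟩, ⟨_, h2⟩)
        have h4 : k / (B + W) * (B + W) + (B + (k % (B + W) - B)) = k := by
          rw [Nat.add_sub_cancel' hkB]
          exact Nat.div_add_mod' k _
        simpa only [Φ, h4] using h3
      funext i
      have := hx i (by omega)
      simp only [ext, i.2, dif_pos] at this
      exact Subtype.ext this
    have := Fintype.card_le_of_injective Φ hΦ
    simpa [Fintype.card_pi, Fintype.card_prod] using this
  have hApos : 0 < Fintype.card A := Fintype.card_pos_iff.mpr ⟨⟨a, ha⟩⟩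
  have hh : 0 ≤ Real.log (Fintype.card A) := Real.log_natCast_nonneg _
  have hlog : ∀ K : ℕ, (K * ((B : ℝ) + W) - T) * Real.log (Fintype.card A) ≤
      K * W * Real.log (Fintype.card X) := by
    intro K
    have h1 : ((K * (B + W) - T : ℕ) : ℝ) * Real.log (Fintype.card A) ≤
        (K * W : ℕ) * Real.log (Fintype.card X) := by
      rw [← Real.log_pow, ← Real.log_pow]
      refine Real.log_le_log (by positivity) ?_
      exact_mod_cast hcount K
    have h2 : (K * ((B : ℝ) + W) - T) ≤ ((K * (B + W) - T : ℕ) : ℝ) := by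
      have : K * (B + W) ≤ (K * (B + W) - T) + T := by omega
      have : ((K * (B + W) : ℕ) : ℝ) ≤ ((K * (B + W) - T : ℕ) : ℝ) + T := by exact_mod_cast this
      push_cast at this
      linarith
    push_cast at h1
    nlinarith
  by_contra! hlt
  obtain ⟨K, hK⟩ := exists_nat_gt (T * Real.log (Fintype.card A) /
    (((B : ℝ) + W) * Real.log (Fintype.card A) - W * Real.log (Fintype.card X)))
  rw [div_lt_iff₀ (by linarith)] at hK
  have := hlog K
  nlinarith

/-- For an erased packet only its own burst matters: the past is known and can be re-encoded, and
the deadline precedes the next burst. For a delivered packet the deadline may reach into the next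
period, so the next burst takes that role. -/
theorem Separates.eq_of_periodic {S X : Type} {f : Encoder S X} {A : Set S} {B T : ℕ}
    (h : Separates f A B T) (K : ℕ) (s s' : ℕ → S) (hs : ∀ i, s i ∈ A) (hs' : ∀ i, s' i ∈ A)
    (hx : ∀ k < K * (B + T), B ≤ k % (B + T) → channelInput f s k = channelInput f s' k)
    (t : ℕ) (ht : t + T < K * (B + T)) : s t = s' t := by
  induction t using Nat.strong_induction_on with
  | _ t ih =>
    have hP : 0 < B + T := Nat.pos_of_ne_zero fun h0 => by simp [h0] at ht
    have hdm := Nat.div_add_mod' t (B + T)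
    have hmod := Nat.mod_lt t hP
    set i := t / (B + T)
    set ρ := t % (B + T)
    have hmod_eq : ∀ l u, u < B + T → (l * (B + T) + u) % (B + T) = u := fun l u hu => by
      rw [Nat.mul_add_mod', Nat.mod_eq_of_lt hu]
    have hpast : ∀ k < t, channelInput f s k = channelInput f s' k := fun k hk =>
      channelInput_congr f fun l hl => ih l (by omega) (by omega)
    have hsucc : (i + 1) * (B + T) = i * (B + T) + (B + T) := by ring
    by_cases hρ : ρ < B
    · refine h (i * (B + T)) t s s' hs hs' fun k hk hj => ?_
      by_cases hkt : k < t
      · exact hpast k hkt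
      · refine hx k (by omega) ?_
        have := hj (by omega)
        obtain ⟨u, rfl⟩ := Nat.exists_eq_add_of_le (by omega : i * (B + T) ≤ k)
        rw [hmod_eq _ _ (by omega)]
        omega
    · refine h ((i + 1) * (B + T)) t s s' hs hs' fun k hk hj => ?_
      by_cases hkt : k < t
      · exact hpast k hkt
      · refine hx k (by omega) ?_
        by_cases hk2 : k < (i + 1) * (B + T)
        · obtain ⟨u, rfl⟩ := Nat.exists_eq_add_of_le (by omega : i * (B + T) ≤ k)
          rw [hmod_eq _ _ (by omega)]
          omega
        · obtain ⟨u, rfl⟩ := Nat.exists_eq_add_of_le (by omega : (i + 1) * (B + T) ≤ k)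
          rw [hmod_eq _ _ (by omega)]
          have := hj (by omega)
          omega

theorem Separates.eq_of_periodic_pair {S X : Type} {f : Encoder S X} {A : Set S}
    {B₁ T₁ B₂ W : ℕ} (h₁ : Separates f A B₁ T₁) (h₂ : Separates f A B₂ (W + B₁))
    (hB : B₁ ≤ B₂) (hT : T₁ ≤ W)
    (K : ℕ) (s s' : ℕ → S) (hs : ∀ i, s i ∈ A) (hs' : ∀ i, s' i ∈ A)
    (hx : ∀ k < K * (B₂ + W), B₂ ≤ k % (B₂ + W) → channelInput f s k = channelInput f s' k)
    (t : ℕ) (ht : t + (W + B₁) < K * (B₂ + W)) : s t = s' t := by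
  induction t using Nat.strong_induction_on with
  | _ t ih =>
    have hP : 0 < B₂ + W := Nat.pos_of_ne_zero fun h0 => by simp [h0] at ht
    have hdm := Nat.div_add_mod' t (B₂ + W)
    have hmod := Nat.mod_lt t hP
    set i := t / (B₂ + W)
    set ρ := t % (B₂ + W)
    have hmod_eq : ∀ l u, u < B₂ + W → (l * (B₂ + W) + u) % (B₂ + W) = u := fun l u hu => by
      rw [Nat.mul_add_mod', Nat.mod_eq_of_lt hu]
    have hpast : ∀ k < t, channelInput f s k = channelInput f s' k := fun k hk =>
      channelInput_congr f fun l hl => ih l (by omega) (by omega)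
    have hsucc : (i + 1) * (B₂ + W) = i * (B₂ + W) + (B₂ + W) := by ring
    by_cases hρ : ρ < B₂
    -- Here `ρ + W + B₁ < B₂ + W`, so receiver 2 meets its deadline before the next burst. The
    -- remaining `B₁` erased packets form a burst for receiver 1.
    · by_cases hρ' : ρ < B₂ - B₁
      · refine h₂ (i * (B₂ + W)) t s s' hs hs' fun k hk hj => ?_
        by_cases hkt : k < t
        · exact hpast k hkt
        · refine hx k (by omega) ?_
          have := hj (by omega)
          obtain ⟨u, rfl⟩ := Nat.exists_eq_add_of_le (by omega : i * (B₂ + W) ≤ k)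
          rw [hmod_eq _ _ (by omega)]
          omega
      · refine h₁ (i * (B₂ + W) + (B₂ - B₁)) t s s' hs hs' fun k hk hj => ?_
        by_cases hkt : k < t
        · exact hpast k hkt
        · refine hx k (by omega) ?_
          have := hj (by omega)
          obtain ⟨u, rfl⟩ := Nat.exists_eq_add_of_le (by omega : i * (B₂ + W) ≤ k)
          rw [hmod_eq _ _ (by omega)]
          omega
    · refine h₂ ((i + 1) * (B₂ + W)) t s s' hs hs' fun k hk hj => ?_
      by_cases hkt : k < t
      · exact hpast k hkt
      · refine hx k (by omega) ?_
        by_cases hk2 : k < (i + 1) * (B₂ + W)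
        · obtain ⟨u, rfl⟩ := Nat.exists_eq_add_of_le (by omega : i * (B₂ + W) ≤ k)
          rw [hmod_eq _ _ (by omega)]
          omega
        · obtain ⟨u, rfl⟩ := Nat.exists_eq_add_of_le (by omega : (i + 1) * (B₂ + W) ≤ k)
          rw [hmod_eq _ _ (by omega)]
          have := hj (by omega)
          omega

theorem rate_le_of_log_le {S X : Type} [Fintype S] [Fintype X] (p : PMF S) [Fintype p.support]
    (hX : 2 ≤ Fintype.card X) {B W : ℝ} (hBW : 0 < B + W)
    (h : (B + W) * Real.log (Fintype.card p.support) ≤ W * Real.log (Fintype.card X)) :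
    entropyBits p / Real.logb 2 (Fintype.card X) ≤ W / (W + B) := by
  classical
  have hlog2 : 0 < Real.log 2 := Real.log_pos (by norm_num)
  have hlogX : 0 < Real.log (Fintype.card X) :=
    Real.log_pos (by exact_mod_cast (by omega : 1 < Fintype.card X))
  have h1 := entropyBits_le p
  rw [le_div_iff₀ hlog2] at h1
  rw [Real.logb, div_div_eq_mul_div, div_le_div_iff₀ hlogX (by linarith)]
  calc entropyBits p * Real.log 2 * (W + B)
      ≤ Real.log (Fintype.card p.support) * (W + B) := by
        gcongr
        linarith
    _ ≤ _ := by linarith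

theorem rate_le_singleUserCapacity {S X : Type} [Fintype S] [Fintype X] {p : PMF S}
    {f : Encoder S X} {B T : ℕ} (hB : 0 < B) (hX : 2 ≤ Fintype.card X) (h : Serves p f B T) :
    entropyBits p / Real.logb 2 (Fintype.card X) ≤ singleUserCapacity B T := by
  classical
  have hsep := h.separates
  unfold singleUserCapacity
  split_ifs with hBT
  · refine rate_le_of_log_le p hX (by positivity) ?_
    exact card_log_le_of_periodic f p.support p.support_nonempty B T T hsep.eq_of_periodic
  · have hcard : Fintype.card p.support ≤ 1 := by
      refine Fintype.card_le_one_iff.mpr fun a a' => Subtype.ext ?_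
      -- When `T < B`, the burst at time 0 hides everything up to the deadline of packet 0.
      exact hsep 0 0 (fun _ => a) (fun _ => a') (fun _ => a.2) (fun _ => a'.2)
        fun k hk hj => absurd (hj (Nat.zero_le _)) (by omega)
    have hlog : Real.log (Fintype.card p.support) ≤ 0 :=
      Real.log_nonpos (by positivity) (by exact_mod_cast hcard)
    have h1 := rate_le_of_log_le p hX (B := 1) (W := 0) (by norm_num) (by simpa using hlog)
    simpa using h1

/-! ### Systematic MDS codes on diagonals -/

/-- The `N × r` array `A` generates a systematic MDS code: its first `r` rows form the identity,
and a codeword that vanishes at `r` of its `N` positions is zero. -/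
def IsSystematicMDS {F : Type} [Field F] (A : ℕ → ℕ → F) (N r : ℕ) : Prop :=
  (∀ c < r, ∀ k < r, A c k = if c = k then 1 else 0) ∧
  ∀ (w : ℕ → F) (K : Finset ℕ), K ⊆ range N → r ≤ #K →
    (∀ c ∈ K, ∑ k ∈ range r, A c k * w k = 0) → ∀ k < r, w k = 0

/-- Reed–Solomon: row `c` evaluates at `c` the interpolant of `w` at the nodes `0, …, r - 1`. It has
degree below `r`, so `r` zeros kill it; `N ≤ p` keeps the points distinct. -/
theorem exists_isSystematicMDS {p N : ℕ} [Fact p.Prime] (hN : N ≤ p) {r : ℕ} (hr : r ≤ N) :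
    ∃ A : ℕ → ℕ → ZMod p, IsSystematicMDS A N r := by
  have hinj : Set.InjOn (fun c : ℕ => (c : ZMod p)) (range N) := by
    intro a ha b hb hab
    rw [coe_range, Set.mem_Iio] at ha hb
    have := (ZMod.natCast_eq_natCast_iff' a b p).mp hab
    rwa [Nat.mod_eq_of_lt (by omega), Nat.mod_eq_of_lt (by omega)] at this
  have hinj' : Set.InjOn (fun c : ℕ => (c : ZMod p)) (range r) :=
    hinj.mono (by simpa using Set.Iio_subset_Iio hr)
  have heval : ∀ (w : ℕ → ZMod p) (c : ℕ),
      ∑ k ∈ range r, (Lagrange.basis (range r) (fun c : ℕ => (c : ZMod p)) k).eval (c : ZMod p) *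
        w k = (Lagrange.interpolate (range r) (fun c : ℕ => (c : ZMod p)) w).eval (c : ZMod p) := by
    intro w c
    rw [Lagrange.interpolate_apply, Polynomial.eval_finsetSum]
    exact sum_congr rfl fun k _ => by rw [Polynomial.eval_mul, Polynomial.eval_C, mul_comm]
  refine ⟨fun c k => (Lagrange.basis (range r) (fun c : ℕ => (c : ZMod p)) k).eval (c : ZMod p),
    fun c hc k hk => ?_, fun w K hK hrK h k hk => ?_⟩
  · split_ifs with hck
    · subst hck
      exact Lagrange.eval_basis_self hinj' (mem_range.mpr hc)
    · exact Lagrange.eval_basis_of_ne (v := fun c : ℕ => (c : ZMod p)) (Ne.symm hck)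
        (mem_range.mpr hc)
  · have hzero : Lagrange.interpolate (range r) (fun c : ℕ => (c : ZMod p)) w = 0 := by
      refine Polynomial.eq_zero_of_degree_lt_of_eval_index_eq_zero (s := K)
        (v := fun c : ℕ => (c : ZMod p)) (hinj.mono (by simpa only [coe_subset] using hK)) ?_ fun c hc => ?_
      · refine (Lagrange.degree_interpolate_lt w hinj').trans_le ?_
        rw [card_range]
        exact_mod_cast hrK
      · rw [← heval]
        exact h c hc
    have := Lagrange.eval_interpolate_at_node w hinj' (mem_range.mpr hk)
    rw [hzero] at this
    simpa using this.symm

theorem IsSystematicMDS.sum_eq {F : Type} [Field F] {A : ℕ → ℕ → F} {N r : ℕ}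
    (hA : IsSystematicMDS A N r) (w : ℕ → F) {c : ℕ} (hc : c < r) :
    ∑ k ∈ range r, A c k * w k = w c := by
  rw [sum_eq_single c]
  · rw [hA.1 c hc c hc, if_pos rfl, one_mul]
  · intro k hk hkc
    rw [hA.1 c hc k (mem_range.mp hk), if_neg (Ne.symm hkc), zero_mul]
  · intro h
    exact absurd (mem_range.mpr hc) h

/-- A diagonal codeword, with position `c` sent at time `e + c * b`, is recovered from an erasure
burst at the times `[j, j + N * b)` when its positions in the last `r * b` time slots of the burst
are known. -/
theorem IsSystematicMDS.eq_zero_of_burst {F : Type} [Field F] {A : ℕ → ℕ → F} {N r : ℕ}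
    (hA : IsSystematicMDS A N r) (hr : r ≤ N) {b : ℤ} (hb : 0 < b) (j e : ℤ) (w : ℕ → F)
    (hout : ∀ k < r, (e + k * b < j ∨ j + N * b ≤ e + k * b) → w k = 0)
    (hin : ∀ c < N, j + N * b ≤ e + c * b + r * b → e + c * b < j + N * b →
      ∑ k ∈ range r, A c k * w k = 0) :
    ∀ k < r, w k = 0 := by
  by_cases hall : ∀ k < r, (e + k * b < j ∨ j + N * b ≤ e + k * b)
  · exact fun k hk => hout k hk (hall k hk)
  push Not at hall
  obtain ⟨k₀, hk₀, hj, hj'⟩ := hall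
  -- `u` indexes the last diagonal slot before the end of the burst. The window holds slots `u + 1 -
  -- r, …, u`. Slots cut off below 0 are replaced by positions after the burst, slots cut off from
  -- `N` on by positions before it, so `r` positions are known in each case.
  obtain ⟨u, hu₁, hu₂⟩ : ∃ u : ℕ, e + u * b < j + N * b ∧ j + N * b ≤ e + u * b + b := by
    have h0 : 0 ≤ j + N * b - 1 - e := by
      have : 0 ≤ (k₀ : ℤ) * b := by positivity
      omega
    have h1 := Int.ediv_nonneg h0 hb.le
    refine ⟨((j + N * b - 1 - e) / b).toNat, ?_⟩
    rw [Int.toNat_of_nonneg h1]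
    have h2 := Int.ediv_mul_add_emod (j + N * b - 1 - e) b
    have h3 := Int.emod_lt_of_pos (j + N * b - 1 - e) hb
    have h4 := Int.emod_nonneg (j + N * b - 1 - e) hb.ne'
    constructor <;> linarith
  have hle : ∀ c d : ℤ, c ≤ d → c * b ≤ d * b := fun c d h => by gcongr
  have hwin : ∀ c : ℕ, c < N → c ≤ u → u + 1 ≤ c + r → ∑ k ∈ range r, A c k * w k = 0 := by
    intro c hcN hcu huc
    have h1 := hle c u (by exact_mod_cast hcu)
    have h2 := hle (u + 1) (c + r) (by exact_mod_cast huc)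
    refine hin c hcN ?_ ?_ <;> linarith
  have huN : u < N + r := by
    by_contra! h
    have := hle (N + k₀ + 1) u (by exact_mod_cast (by omega))
    linarith
  rcases lt_or_ge u (r - 1) with h | h
  · refine hA.2 w (range r) (by simpa using hr) (by simp) fun c hc => ?_
    rw [mem_range] at hc
    by_cases hcu : c ≤ u
    · exact hwin c (by omega) hcu (by omega)
    · rw [hA.sum_eq w hc]
      refine hout c hc (Or.inr ?_)
      have := hle (u + 1) c (by exact_mod_cast (by omega : u + 1 ≤ c))
      linarith
  rcases lt_or_ge u N with h' | h'
  · refine hA.2 w (Ico (u + 1 - r) (u + 1)) ?_ ?_ fun c hc => ?_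
    · intro c hc
      rw [mem_Ico] at hc
      rw [mem_range]
      omega
    · rw [Nat.card_Ico]
      omega
    · rw [mem_Ico] at hc
      exact hwin c (by omega) (by omega) (by omega)
  · refine hA.2 w (range (u + 1 - N) ∪ Ico (u + 1 - r) N) ?_ ?_ fun c hc => ?_
    · intro c hc
      rw [mem_union, mem_range, mem_Ico] at hc
      rw [mem_range]
      omega
    · rw [card_union_of_disjoint, card_range, Nat.card_Ico]
      · omega
      · rw [disjoint_left]
        intro c hc hc'
        rw [mem_range] at hc
        rw [mem_Ico] at hc'
        omega
    · rw [mem_union, mem_range, mem_Ico] at hc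
      rcases hc with hc | hc
      · rw [hA.sum_eq w (by omega)]
        refine hout c (by omega) (Or.inl ?_)
        have := hle (c + N) u (by exact_mod_cast (by omega : c + N ≤ u))
        linarith
      · exact hwin c (by omega) (by omega) (by omega)

/-! ### The superposed parities -/

/-- The source symbol that the parity symbol `c` repeats in its block `i`. -/
def blockIndex (N r c i : ℕ) : ℕ := if c < r then (i + 1) * N + c else i * N + c

/-- The parity symbol `c` at time `t` of the stream `σ` of `m * N + r` symbols per time slot: the sum
of the parity of a code with delay `(m * N + r) * b` for bursts of length `N * b`, and of the parity
of a code with delay `(m * N + r) * g` for bursts of length `N * g`, with the roles of the source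
symbols reversed, shifted by `(m * N + r + N) * b`. -/
def parity {F : Type} [Field F] (A : ℕ → ℕ → F) (N m r b g : ℕ) (σ : ℕ → ℤ → F) (c : ℕ) (t : ℤ) :
    F :=
  (∑ k ∈ range r, A c k * σ k (t - (c + r - k) * b) +
    ∑ i ∈ range m, σ (blockIndex N r c i) (t - ((i + 1) * (N * b) + r * b))) +
  (∑ k ∈ range r, A c k * σ (m * N + k) (t - ((m + 1) * (N * b) + r * b) - (c + r - k) * g) +
    ∑ i ∈ range m, σ (i * N + c)
      (t - ((m + 1) * (N * b) + r * b) - ((m - i) * (N * g) + r * g)))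

theorem parity_sub {F : Type} [Field F] (A : ℕ → ℕ → F) (N m r b g : ℕ) (σ σ' : ℕ → ℤ → F) (c : ℕ)
    (t : ℤ) : parity A N m r b g (fun x y => σ x y - σ' x y) c t =
      parity A N m r b g σ c t - parity A N m r b g σ' c t := by
  simp only [parity, mul_sub, sum_sub_distrib]
  ring

theorem parity_congr {F : Type} [Field F] (A : ℕ → ℕ → F) (N m r b g : ℕ) {σ σ' : ℕ → ℤ → F}
    (c : ℕ) {t : ℤ} (h : ∀ x y, y ≤ t → σ x y = σ' x y) :
    parity A N m r b g σ c t = parity A N m r b g σ' c t := by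
  have hnn : ∀ a a' : ℕ, 0 ≤ (a : ℤ) * a' := fun a a' => by positivity
  have hlag : ∀ {k d : ℕ}, k ∈ range r → 0 ≤ ((c : ℤ) + r - k) * d := by
    intro k d hk
    rw [mem_range] at hk
    exact mul_nonneg (by omega) (by positivity)
  have hΔ : 0 ≤ ((m : ℤ) + 1) * (N * b) + r * b := by positivity
  unfold parity
  congr 1 <;> congr 1
  · refine sum_congr rfl fun k hk => ?_
    rw [h _ _ (by linarith [hlag (d := b) hk])]
  · refine sum_congr rfl fun i hi => h _ _ ?_
    have : 0 ≤ ((i : ℤ) + 1) * (N * b) + r * b := by positivity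
    linarith
  · refine sum_congr rfl fun k hk => ?_
    rw [h _ _ (by linarith [hlag (d := g) hk])]
  · refine sum_congr rfl fun i hi => h _ _ ?_
    rw [mem_range] at hi
    have : 0 ≤ ((m : ℤ) - i) * (N * g) := mul_nonneg (by omega) (by positivity)
    linarith [hnn r g]

/-- Symbols below `r` are protected by the MDS sum, so for `c < r` the repetitions start one block
later and still reach every index from `r` on. -/
theorem exists_blockIndex {N r m x : ℕ} (hr : r < N) (hx : r ≤ x) (hxM : x < m * N + r) :
    ∃ c < N, ∃ i < m, x = blockIndex N r c i := by
  have h1 := Nat.div_add_mod' x N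
  have h2 := Nat.mod_lt x (by omega : 0 < N)
  have h3 : x / N ≤ m := by
    by_contra! h
    have h4 := Nat.mul_le_mul_right N h
    rw [Nat.succ_mul] at h4
    omega
  unfold blockIndex
  generalize x / N = d at *
  by_cases hc : x % N < r
  · have h4 : d ≠ 0 := by
      intro h0
      rw [h0] at h1
      omega
    refine ⟨x % N, h2, d - 1, by omega, ?_⟩
    rw [if_pos hc, Nat.sub_add_cancel (by omega)]
    exact h1.symm
  · have h4 : d ≠ m := by
      intro h0
      rw [h0] at h1
      omega
    refine ⟨x % N, h2, d, by omega, ?_⟩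
    rw [if_neg hc]
    exact h1.symm

/-! ### Decoding after short and long bursts -/

section Decoding

variable {F : Type} [Field F] {A : ℕ → ℕ → F} {N m r b g : ℕ} {σ : ℕ → ℤ → F} {j t₀ : ℤ}

theorem eq_zero_of_short_burst (hA : IsSystematicMDS A N r) (hr : r < N) (hm : 0 < m) (hb : 0 < b)
    (hj : j ≤ t₀) (hj' : t₀ < j + N * b)
    (hpast : ∀ x y, y < j → σ x y = 0)
    (hsys : ∀ x y, j + N * b ≤ y → y ≤ t₀ + (m * (N * b) + r * b) → σ x y = 0)
    (hq : ∀ c < N, ∀ t, j + N * b ≤ t → t ≤ t₀ + (m * (N * b) + r * b) →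
      parity A N m r b g σ c t = 0) :
    ∀ x < m * N + r, σ x t₀ = 0 := by
  have hN : 0 < N := by omega
  have hNb : 0 < (N : ℤ) * b := by positivity
  have hrb : 0 ≤ (r : ℤ) * b := by positivity
  have hrNb : (r : ℤ) * b ≤ N * b := by gcongr
  have hle : ∀ a d : ℤ, a ≤ d → a * (N * b) ≤ d * (N * b) := fun a d h => by gcongr
  have hle' : ∀ a d : ℤ, a ≤ d → a * b ≤ d * b := fun a d h => by gcongr
  have hmb := hle 1 m (by exact_mod_cast hm)
  have hq' : ∀ c < N, ∀ t, j + N * b ≤ t → t ≤ t₀ + (m * (N * b) + r * b) →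
      ∑ k ∈ range r, A c k * σ k (t - (c + r - k) * b) +
        ∑ i ∈ range m, σ (blockIndex N r c i) (t - ((i + 1) * (N * b) + r * b)) = 0 := by
    intro c hc t ht ht'
    have h := hq c hc t ht ht'
    -- Up to the deadline, the shift `(m + 1) * (N * b) + r * b` places all terms of the second code
    -- before the burst.
    unfold parity at h
    rw [sum_eq_zero (s := range r)
      (f := fun k => A c k * σ (m * N + k) (t - ((m + 1) * (N * b) + r * b) - (c + r - k) * g)),
      sum_eq_zero (s := range m) (f := fun i => σ (i * N + c)
      (t - ((m + 1) * (N * b) + r * b) - ((m - i) * (N * g) + r * g))), add_zero, add_zero] at h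
    · exact h
    · intro i hi
      rw [mem_range] at hi
      have h1 : 0 ≤ ((m : ℤ) - i) * (N * g) := mul_nonneg (by omega) (by positivity)
      have h2 : 0 ≤ (r : ℤ) * g := by positivity
      exact hpast _ _ (by linarith)
    · intro k hk
      rw [mem_range] at hk
      have h1 : 0 ≤ ((c : ℤ) + r - k) * g := mul_nonneg (by omega) (by positivity)
      rw [hpast _ _ (by linarith), mul_zero]
  have hv : ∀ k < r, ∀ y, y ≤ t₀ + (m * (N * b) + r * b) → σ k y = 0 := by
    intro k₀ hk₀ y hy
    rcases lt_or_ge y j with h1 | h1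
    · exact hpast _ _ h1
    rcases le_or_gt (j + N * b) y with h2 | h2
    · exact hsys _ _ h2 hy
    have hk₀b : 0 ≤ (k₀ : ℤ) * b := by positivity
    have := hA.eq_zero_of_burst hr.le (b := b) (by exact_mod_cast hb) j (y - k₀ * b)
      (fun k => σ k (y - k₀ * b + k * b)) ?_ ?_ k₀ hk₀
    · simpa using this
    · intro k hk hout
      have hkr := hle' (k : ℤ) r (by exact_mod_cast hk.le)
      rcases hout with h3 | h3
      · exact hpast _ _ h3
      · exact hsys _ _ h3 (by linarith)
    · intro c hc h3 h4
      have h := hq' c hc (y - k₀ * b + c * b + r * b) (by linarith) (by linarith)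
      rw [sum_eq_zero (s := range m), add_zero] at h
      · rw [← h]
        refine sum_congr rfl fun k _ => ?_
        congr 2
        ring
      · intro i _
        have := hle 1 (i + 1) (by omega)
        exact hpast _ _ (by linarith)
  have hblock : ∀ i < m, ∀ c < N, ∀ t ≤ t₀ + (m * (N * b) + r * b),
      σ (blockIndex N r c i) (t - ((i + 1) * (N * b) + r * b)) = 0 := by
    intro i
    induction i using Nat.strong_induction_on with
    | _ i ih =>
      intro hi c hc t ht
      have hlag := hle 1 (i + 1) (by omega)
      rcases lt_or_ge (t - (((i : ℤ) + 1) * (N * b) + r * b)) j with h1 | h1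
      · exact hpast _ _ h1
      rcases le_or_gt (j + N * b) (t - (((i : ℤ) + 1) * (N * b) + r * b)) with h2 | h2
      · exact hsys _ _ h2 (by linarith)
      have h := hq' c hc t (by linarith) ht
      -- Blocks below `i` are known by induction; blocks above `i` refer at least `N * b` further
      -- back, before the burst.
      rw [sum_eq_zero (s := range r), zero_add, sum_eq_single i] at h
      · exact h
      · intro i' hi' hne
        rcases lt_or_gt_of_ne hne with h3 | h3
        · exact ih i' h3 (mem_range.mp hi') c hc t ht
        · have := hle (i + 1 + 1) (i' + 1) (by omega)
          exact hpast _ _ (by linarith)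
      · intro h3
        exact absurd (mem_range.mpr hi) h3
      · intro k hk
        rw [mem_range] at hk
        have := hle' 0 (c + r - k) (by omega)
        rw [hv k hk _ (by linarith), mul_zero]
  intro x hx
  by_cases hxr : x < r
  · exact hv x hxr _ (by linarith)
  · obtain ⟨c, hc, i, hi, rfl⟩ := exists_blockIndex hr (not_lt.mp hxr) hx
    have hlag := hle (i + 1) m (by omega)
    have := hblock i hi c hc (t₀ + ((i + 1) * (N * b) + r * b)) (by linarith)
    simpa using this

/-- Symbols in the last `N * b` slots of the burst are read from the first code, earlier ones from
the second. The order is: the symbols `m * N + k`, then the blocks by decreasing index, with block 0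
last. -/
theorem eq_zero_of_long_burst (hA : IsSystematicMDS A N r) (hr : r < N) (hm : 0 < m) (hb : 0 < b)
    (hg : 0 < g) (hj : j ≤ t₀)
    (hpast : ∀ x y, y < j → σ x y = 0)
    (hsys : ∀ x y, j + (N * b + N * g) ≤ y →
      y ≤ t₀ + ((m + 1) * (N * b) + r * b) + (m * (N * g) + r * g) → σ x y = 0)
    (hq : ∀ c < N, ∀ t, j + (N * b + N * g) ≤ t →
      t ≤ t₀ + ((m + 1) * (N * b) + r * b) + (m * (N * g) + r * g) →
      parity A N m r b g σ c t = 0) :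
    ∀ x < m * N + r, σ x t₀ = 0 := by
  have hN : 0 < N := by omega
  have hNb : 0 < (N : ℤ) * b := by positivity
  have hNg : 0 < (N : ℤ) * g := by positivity
  have hrb : 0 ≤ (r : ℤ) * b := by positivity
  have hrg : 0 ≤ (r : ℤ) * g := by positivity
  have hrNb : (r : ℤ) * b ≤ N * b := by gcongr
  have hrNg : (r : ℤ) * g ≤ N * g := by gcongr
  have hle : ∀ a d : ℤ, a ≤ d → a * (N * b) ≤ d * (N * b) := fun a d h => by gcongr
  have hle' : ∀ a d : ℤ, a ≤ d → a * b ≤ d * b := fun a d h => by gcongr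
  have hleg : ∀ a d : ℤ, a ≤ d → a * (N * g) ≤ d * (N * g) := fun a d h => by gcongr
  have hleg' : ∀ a d : ℤ, a ≤ d → a * g ≤ d * g := fun a d h => by gcongr
  have hmb := hle 1 m (by exact_mod_cast hm)
  have hmg := hleg 1 m (by exact_mod_cast hm)
  set D : ℤ := t₀ + ((m + 1) * (N * b) + r * b) + (m * (N * g) + r * g) with hD
  -- a symbol is known at every time up to `D` once it is known throughout the burst
  have hext : ∀ x, (∀ y, j ≤ y → y < j + (N * b + N * g) → σ x y = 0) → ∀ y ≤ D, σ x y = 0 := by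
    intro x hx y hy
    rcases lt_or_ge y j with h1 | h1
    · exact hpast _ _ h1
    rcases le_or_gt (j + (N * b + N * g)) y with h2 | h2
    · exact hsys _ _ h2 hy
    · exact hx y h1 h2
  -- the first summand of the parity is known late after the burst
  have hqII : ∀ c < N, ∀ t, j + (N * b + N * g) + (m * (N * b) + r * b) ≤ t → t ≤ D →
      ∑ k ∈ range r, A c k * σ (m * N + k) (t - ((m + 1) * (N * b) + r * b) - (c + r - k) * g) +
        ∑ i ∈ range m, σ (i * N + c)
          (t - ((m + 1) * (N * b) + r * b) - ((m - i) * (N * g) + r * g)) = 0 := by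
    intro c hc t ht ht'
    have h := hq c hc t (by linarith) ht'
    unfold parity at h
    rw [sum_eq_zero (s := range r)
      (f := fun k => A c k * σ k (t - (c + r - k) * b)),
      sum_eq_zero (s := range m)
        (f := fun i => σ (blockIndex N r c i) (t - ((i + 1) * (N * b) + r * b))),
      zero_add, zero_add] at h
    · exact h
    · intro i hi
      rw [mem_range] at hi
      have h1 := hle (i + 1) m (by omega)
      have h2 := hle 0 (i + 1) (by omega)
      exact hsys _ _ (by linarith) (by linarith)
    · intro k hk
      rw [mem_range] at hk
      have h1 := hle' 0 (c + r - k) (by omega)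
      have h2 := hle' (c + r - k) (N + r) (by omega)
      rw [hsys _ _ (by linarith) (by linarith), mul_zero]
  -- Induction on the start `e` of the diagonal. Symbol `m * N + k` has the longest repetition delay
  -- in the first code; the only unresolved interference there is the same symbol on the earlier
  -- diagonal `e - N * b - r * g`.
  have hz' : ∀ n : ℕ, ∀ e : ℤ, e < j - r * g + n → ∀ k < r, e + k * g < j + (N * b + N * g) →
      σ (m * N + k) (e + k * g) = 0 := by
    intro n
    induction n with
    | zero =>
      intro e he k hk _
      have := hleg' k r (by omega)
      push_cast at he
      exact hpast _ _ (by linarith)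
    | succ n ih =>
      intro e he
      push_cast at he
      have hB : ∀ k < r, j + N * g ≤ e + k * g → e + k * g < j + (N * b + N * g) →
          σ (m * N + k) (e + k * g) = 0 := by
        intro k hk h1 h2
        have h := hq k (by omega) (e + k * g + (m * (N * b) + r * b)) (by linarith) (by linarith)
        unfold parity at h
        rw [hA.sum_eq (fun k' => σ k' _) hk, hA.sum_eq (fun k' => σ (m * N + k') _) hk,
          hsys k _ (by linarith) (by linarith), sum_eq_single (m - 1),
          sum_eq_zero (s := range m), zero_add, add_zero] at h
        · have h3 : e + k * g + (m * (N * b) + r * b) - ((m + 1) * (N * b) + r * b) -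
              (k + r - k) * g = (e - N * b - r * g) + k * g := by ring
          have h4 : blockIndex N r k (m - 1) = m * N + k := by
            unfold blockIndex
            rw [if_pos hk, Nat.sub_add_cancel hm]
          have h5 : (((m - 1 : ℕ) : ℤ) + 1) = m := by omega
          rw [h3, ih _ (by linarith) k hk (by linarith), add_zero, h4, h5] at h
          simpa using h
        · intro i hi
          rw [mem_range] at hi
          have := hleg 1 (m - i) (by omega)
          exact hpast _ _ (by linarith)
        · intro i hi hne
          rw [mem_range] at hi
          have h3 := hle (i + 1 + 1) m (by omega)
          have h4 := hle 0 (i + 1) (by omega)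
          exact hsys _ _ (by linarith) (by linarith)
        · intro h3
          exact absurd (mem_range.mpr (by omega)) h3
      intro k hk hk'
      rcases lt_or_ge (e + k * g) j with h1 | h1
      · exact hpast _ _ h1
      rcases le_or_gt (j + N * g) (e + k * g) with h2 | h2
      · exact hB k hk h2 hk'
      have hkg := hleg' 0 k (by omega)
      refine hA.eq_zero_of_burst hr.le (b := g) (by exact_mod_cast hg) j e
        (fun k => σ (m * N + k) (e + k * g)) ?_ ?_ k hk
      · intro k' hk'' hout
        have := hleg' k' r (by omega)
        rcases hout with h3 | h3
        · exact hpast _ _ h3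
        · rcases le_or_gt (j + (N * b + N * g)) (e + k' * g) with h4 | h4
          · exact hsys _ _ h4 (by linarith)
          · exact hB k' hk'' h3 h4
      · intro c hc h3 h4
        have h := hqII c hc (e + c * g + r * g + ((m + 1) * (N * b) + r * b)) (by linarith)
          (by linarith)
        rw [sum_eq_zero (s := range m), add_zero] at h
        · rw [← h]
          refine sum_congr rfl fun k _ => ?_
          congr 2
          ring
        · intro i hi
          rw [mem_range] at hi
          have := hleg 1 (m - i) (by omega)
          exact hpast _ _ (by linarith)
  have hz : ∀ k < r, ∀ y ≤ D, σ (m * N + k) y = 0 := by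
    intro k hk
    refine hext _ fun y h1 h2 => ?_
    have := hz' (y - k * g - (j - r * g) + 1).toNat (y - k * g) (by omega) k hk (by linarith)
    simpa using this
  have hq₀ : ∀ c < N, ∀ t, j + (N * b + N * g) + (m * (N * b) + r * b) ≤ t → t ≤ D →
      ∑ i ∈ range m, σ (i * N + c)
        (t - ((m + 1) * (N * b) + r * b) - ((m - i) * (N * g) + r * g)) = 0 := by
    intro c hc t ht ht'
    have h := hqII c hc t ht ht'
    rwa [sum_eq_zero (s := range r), zero_add] at h
    intro k hk
    rw [mem_range] at hk
    have := hleg' 0 (c + r - k) (by omega)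
    rw [hz k hk _ (by linarith), mul_zero]
  -- Block 0 is excluded: its repetition in the second code arrives by `D` only for times up to
  -- `t₀`, and its symbols with `c < r` are not repeated in the first code.
  have hw : ∀ n : ℕ, ∀ i < m, 0 < i → m ≤ i + n → ∀ c < N, ∀ y ≤ D, σ (i * N + c) y = 0 := by
    intro n
    induction n with
    | zero => intro i hi _ hi'; omega
    | succ n ih =>
      intro i hi hi0 hin c hc
      have hi1 := hleg 1 i (by omega)
      refine hext _ fun y h1 h2 => ?_
      rcases lt_or_ge y (j + N * g) with h3 | h3
      · have hmi := hleg 1 (m - i) (by omega)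
        have hmi' : ((m : ℤ) - i) * (N * g) = m * (N * g) - i * (N * g) := by ring
        have h := hq₀ c hc
          (y + ((m + 1) * (N * b) + r * b) + ((m - i) * (N * g) + r * g)) (by linarith)
          (by linarith)
        rw [sum_eq_single i] at h
        · rw [← h]
          congr 1
          ring
        · intro i' hi' hne
          rw [mem_range] at hi'
          rcases lt_or_gt_of_ne hne with h4 | h4
          · have := hleg (m - i + 1) (m - i') (by omega)
            exact hpast _ _ (by linarith)
          · have := hleg 0 (m - i') (by omega)
            exact ih i' hi' (by omega) (by omega) c hc _ (by linarith)
        · intro h4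
          exact absurd (mem_range.mpr hi) h4
      · obtain ⟨a, ha, hai, haci⟩ : ∃ a < m, blockIndex N r c a = i * N + c ∧
            ((c < r ∧ a + 1 = i) ∨ (¬ c < r ∧ a = i)) := by
          by_cases hcr : c < r
          · exact ⟨i - 1, by omega, by unfold blockIndex; rw [if_pos hcr, Nat.sub_add_cancel hi0],
              Or.inl ⟨hcr, by omega⟩⟩
          · exact ⟨i, hi, by unfold blockIndex; rw [if_neg hcr], Or.inr ⟨hcr, rfl⟩⟩
        have ha1 := hle 1 (a + 1) (by omega)
        have ham := hle (a + 1) m (by omega)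
        -- In this parity the repetitions with index below `a` refer to times after the burst, and
        -- those above `a` to symbols of higher blocks, already recovered.
        have h := hq c hc (y + ((a + 1) * (N * b) + r * b)) (by linarith) (by linarith)
        unfold parity at h
        rw [sum_eq_zero (s := range r) (f := fun k => A c k * σ (m * N + k) _),
          sum_eq_zero (s := range m) (f := fun i => σ (i * N + c) _),
          sum_eq_zero (s := range r), sum_eq_single a, zero_add, add_zero, add_zero, hai] at h
        · simpa using h
        · intro a' ha' hne
          rw [mem_range] at ha'
          have ha'1 := hle 0 (a' + 1) (by omega)
          rcases lt_or_gt_of_ne hne with h4 | h4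
          · have := hle (a' + 1 + 1) (a + 1) (by omega)
            exact hsys _ _ (by linarith) (by linarith)
          · rcases haci with ⟨hcr, rfl⟩ | ⟨hcr, rfl⟩
            · unfold blockIndex
              rw [if_pos hcr]
              rcases Nat.lt_or_ge (a' + 1) m with h5 | h5
              · exact ih (a' + 1) h5 (by omega) (by omega) c hc _ (by linarith)
              · rw [(by omega : a' + 1 = m)]
                exact hz c hcr _ (by linarith)
            · unfold blockIndex
              rw [if_neg hcr]
              exact ih a' ha' (by omega) (by omega) c hc _ (by linarith)
        · intro h4
          exact absurd (mem_range.mpr ha) h4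
        · intro k hk
          rw [mem_range] at hk
          have hlag := hle' 0 (c + r - k) (by omega)
          by_cases hck : c = k
          · subst hck
            have h4 : ((c : ℤ) + r - c) * b = r * b := by ring
            rw [hsys _ _ (by linarith) (by linarith), mul_zero]
          · by_cases hcr : c < r
            · rw [hA.1 c hcr k hk, if_neg hck, zero_mul]
            · have ha2 := hle 2 (a + 1) (by omega)
              have h4 := hle' (c + r - k) (N + r) (by omega)
              rw [hsys _ _ (by linarith) (by linarith), mul_zero]
        · intro i' hi'
          rw [mem_range] at hi'
          have := hleg 1 (m - i') (by omega)
          exact hpast _ _ (by linarith)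
        · intro k hk
          rw [mem_range] at hk
          have := hleg' 0 (c + r - k) (by omega)
          rw [hz k hk _ (by linarith), mul_zero]
  intro x hx
  have hxdm := Nat.div_add_mod' x N
  have hxmod := Nat.mod_lt x hN
  have hxm : x / N ≤ m := by
    by_contra! h
    have h4 := Nat.mul_le_mul_right N h
    rw [Nat.succ_mul] at h4
    omega
  rcases Nat.lt_or_ge (x / N) m with h1 | h1
  · rw [← hxdm]
    rcases Nat.eq_zero_or_pos (x / N) with h2 | h2
    -- At time `D` the block 0 term sits exactly at `t₀`: the whole delay is used.
    · have h := hq₀ (x % N) hxmod D (by linarith) le_rfl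
      rw [sum_eq_single 0] at h
      · rw [h2, ← h]
        congr 1
        push_cast
        linarith
      · intro i hi hne
        rw [mem_range] at hi
        have := hleg 0 (m - i) (by omega)
        exact hw m i hi (by omega) (by omega) _ hxmod _ (by linarith)
      · intro h3
        exact absurd (mem_range.mpr hm) h3
    · exact hw m _ h1 h2 (by omega) _ hxmod _ (by linarith)
  · have h2 : x / N = m := by omega
    rw [← hxdm, h2]
    rw [h2] at hxdm
    exact hz _ (by omega) _ (by linarith)

end Decoding

/-! ### The encoder and its separation properties -/

/-- A stream of source packets as a family of streams of symbols indexed by all integers, with zero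
symbols before time zero. -/
def extendByZero {F : Type} [Field F] {M : ℕ} (s : ℕ → Fin M → F) (x : ℕ) (y : ℤ) : F :=
  if h : x < M then if 0 ≤ y then s y.toNat ⟨x, h⟩ else 0 else 0

/-- The systematic encoder that appends `N` parity symbols to the `m * N + r` source symbols. -/
def parityEncoder {F : Type} [Field F] (A : ℕ → ℕ → F) (N m r b g : ℕ) :
    Encoder (Fin (m * N + r) → F) ((Fin (m * N + r) → F) × (Fin N → F)) := fun t w =>
  (w (Fin.last t), fun c =>
    -- Clamping by `min i t` is harmless, since all lags in the parity are nonnegative.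
    parity A N m r b g (extendByZero fun i => w ⟨min i t, by omega⟩) c t)

theorem channelInput_parityEncoder {F : Type} [Field F] (A : ℕ → ℕ → F) (N m r b g : ℕ)
    (s : ℕ → Fin (m * N + r) → F) (t : ℕ) :
    channelInput (parityEncoder A N m r b g) s t =
      (s t, fun c : Fin N => parity A N m r b g (extendByZero s) c t) := by
  unfold channelInput parityEncoder
  refine Prod.ext rfl ?_
  funext c
  refine parity_congr A N m r b g c fun x y hy => ?_
  unfold extendByZero
  have : min y.toNat t = y.toNat := by omega
  simp only [this]

section Separation

variable {F : Type} [Field F] {A : ℕ → ℕ → F} {N m r b g : ℕ}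

/-- It suffices to recover the difference of two streams with equal unerased channel packets. -/
theorem separates_parityEncoder {B T : ℕ}
    (h : ∀ (σ : ℕ → ℤ → F) (j t₀ : ℤ), j ≤ t₀ → t₀ < j + B → (∀ x y, y < j → σ x y = 0) →
      (∀ x y, j + B ≤ y → y ≤ t₀ + T → σ x y = 0) →
      (∀ c < N, ∀ t, j + B ≤ t → t ≤ t₀ + T → parity A N m r b g σ c t = 0) →
      ∀ x < m * N + r, σ x t₀ = 0) :
    Separates (parityEncoder A N m r b g) Set.univ B T := by
  intro j t s s' _ _ hx
  simp only [channelInput_parityEncoder, Prod.mk.injEq] at hx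
  by_cases hjt : j ≤ t ∧ t < j + B
  · have hsub : ∀ k ≤ t + T, (j ≤ k → j + B ≤ k) →
        ∀ x, extendByZero s x k - extendByZero s' x k = 0 := by
      intro k hk hjk x
      have := (hx k hk hjk).1
      simp only [extendByZero, Int.toNat_natCast, this, sub_self]
    funext x
    have hzero := h (fun x y => extendByZero s x y - extendByZero s' x y) j t
      (by exact_mod_cast hjt.1) (by exact_mod_cast hjt.2) ?_ ?_ ?_ x x.2
    · simpa [extendByZero, sub_eq_zero] using hzero
    · intro x y hy
      by_cases hy0 : 0 ≤ y
      · lift y to ℕ using hy0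
        exact hsub y (by omega) (by omega) x
      · simp [extendByZero, hy0]
    · intro x y hy hy'
      lift y to ℕ using (by omega)
      exact hsub y (by omega) (by omega) x
    · intro c hc y hy hy'
      lift y to ℕ using (by omega)
      rw [parity_sub, sub_eq_zero]
      exact congrFun (hx y (by omega) (by omega)).2 ⟨c, hc⟩
  · exact (hx t (by omega) (by omega)).1

theorem separates_short (hA : IsSystematicMDS A N r) (hr : r < N) (hm : 0 < m) (hb : 0 < b) :
    Separates (parityEncoder A N m r b g) Set.univ (N * b) ((m * N + r) * b) := by
  refine separates_parityEncoder fun σ j t₀ hj hj' hpast hsys hq => ?_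
  have hT : (((m * N + r) * b : ℕ) : ℤ) = m * (N * b) + r * b := by push_cast; ring
  rw [hT] at hsys hq
  push_cast at hj' hsys hq
  exact eq_zero_of_short_burst hA hr hm hb hj hj' hpast hsys hq

theorem separates_long (hA : IsSystematicMDS A N r) (hr : r < N) (hm : 0 < m) (hb : 0 < b)
    (hg : 0 < g) : Separates (parityEncoder A N m r b g) Set.univ (N * (b + g))
      ((m * N + r + N) * b + (m * N + r) * g) := by
  refine separates_parityEncoder fun σ j t₀ hj _ hpast hsys hq => ?_
  have hT : t₀ + (((m * N + r + N) * b + (m * N + r) * g : ℕ) : ℤ) =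
      t₀ + ((m + 1) * (N * b) + r * b) + (m * (N * g) + r * g) := by push_cast; ring
  have hB : ((N * (b + g) : ℕ) : ℤ) = N * b + N * g := by push_cast; ring
  rw [hT, hB] at hsys hq
  exact eq_zero_of_long_burst hA hr hm hb hg hj hpast hsys hq

end Separation

/-- A code of rate `M / (M + N)` for bursts of length `N * b` with delay `M * b` and for bursts of
length `N * (b + g)` with delay `(M + N) * b + M * g`. -/
theorem exists_separating_code {N M b g : ℕ} (hN : 0 < N) (hM : N ≤ M) (hb : 0 < b) (hg : 0 < g) :
    ∃ q : ℕ, 2 ≤ q ∧ ∃ (S X : Type) (_ : Fintype S) (_ : Fintype X) (f : Encoder S X),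
      Fintype.card S = q ^ M ∧ Fintype.card X = q ^ (M + N) ∧
      Separates f Set.univ (N * b) (M * b) ∧
      Separates f Set.univ (N * (b + g)) ((M + N) * b + M * g) := by
  obtain ⟨q, hNq, hq⟩ := Nat.exists_infinite_primes N
  have : Fact q.Prime := ⟨hq⟩
  obtain ⟨m, r, hr, hm, rfl⟩ : ∃ m r, r < N ∧ 0 < m ∧ M = m * N + r :=
    ⟨M / N, M % N, Nat.mod_lt _ hN, Nat.div_pos hM hN, (Nat.div_add_mod' M N).symm⟩
  obtain ⟨A, hA⟩ := exists_isSystematicMDS hNq hr.le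
  refine ⟨q, hq.two_le, _, _, inferInstance, inferInstance, parityEncoder A N m r b g, ?_, ?_,
    separates_short hA hr hm hb, separates_long hA hr hm hb hg⟩
  · simp
  · simp [pow_add]

/-! ### Blocking and achievable rates -/

/-- The encoder that splits each packet into `n` packets of the encoder `f`. -/
def blockEncoder {S X : Type} (f : Encoder S X) (n : ℕ) : Encoder (Fin n → S) (Fin n → X) :=
  fun t w i => f (t * n + i) fun k =>
    have hn : 0 < n := i.pos
    w ⟨k / n, Nat.div_lt_of_lt_mul (by
      have := k.2; have := i.2; have : n * (t + 1) = t * n + n := by ring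
      omega)⟩
      ⟨k % n, Nat.mod_lt _ hn⟩

/-- A burst of `B` blocks erases `n * B` inner slots, and the inner deadline `t * n + i + T'` falls
no later than block `t + T`. -/
theorem Separates.block {S X : Type} {f : Encoder S X} {n B T T' : ℕ}
    (h : Separates f Set.univ (n * B) T') (hT : T' ≤ n * T) :
    Separates (blockEncoder f n) Set.univ B T := by
  intro j t s s' _ _ hx
  funext i
  have hn : 0 < n := i.pos
  let flat : (ℕ → Fin n → S) → ℕ → S := fun s k => s (k / n) ⟨k % n, Nat.mod_lt _ hn⟩
  have hflat : ∀ (s : ℕ → Fin n → S) (k : ℕ) (i : Fin n), flat s (k * n + i) = s k i := by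
    intro s k i
    have h1 : (k * n + i) / n = k := by
      rw [Nat.mul_comm, Nat.mul_add_div hn, Nat.div_eq_of_lt i.2, add_zero]
    have h2 : (k * n + i) % n = i := by rw [Nat.mul_add_mod', Nat.mod_eq_of_lt i.2]
    simp only [flat, h1, h2]
  rw [← hflat s, ← hflat s']
  refine h (j * n) _ _ _ (fun _ => trivial) (fun _ => trivial) fun k hk hjk => ?_
  have hdm := Nat.div_add_mod' k n
  have hmod := Nat.mod_lt k hn
  have hkt : k / n ≤ t + T := by
    refine Nat.lt_succ_iff.mp (Nat.div_lt_of_lt_mul ?_)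
    have h1 : n * (t + T).succ = t * n + n * T + n := by rw [Nat.succ_eq_add_one]; ring
    have := i.2
    omega
  have hkj : j ≤ k / n → j + B ≤ k / n := by
    intro hj
    have h1 := hjk ((Nat.le_div_iff_mul_le hn).mp hj)
    rw [Nat.le_div_iff_mul_le hn]
    linarith
  have := congrFun (hx (k / n) hkt hkj) ⟨k % n, hmod⟩
  have hblock : ∀ s : ℕ → Fin n → S,
      channelInput (blockEncoder f n) s (k / n) ⟨k % n, hmod⟩ = channelInput f (flat s) k := by
    intro s
    change channelInput f (flat s) (k / n * n + k % n) = _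
    rw [hdm]
  rwa [hblock, hblock] at this

theorem entropyBits_uniformOfFintype (S : Type) [Fintype S] [Nonempty S] :
    entropyBits (PMF.uniformOfFintype S) = Real.log (Fintype.card S) / Real.log 2 := by
  have hS : (Fintype.card S : ℝ) ≠ 0 := by exact_mod_cast Fintype.card_ne_zero
  unfold entropyBits
  simp only [PMF.uniformOfFintype_apply, ENNReal.toReal_inv, ENNReal.toReal_natCast,
    Real.negMulLog, Real.log_inv, sum_const, card_univ, nsmul_eq_mul]
  field_simp

theorem mem_achievableRates_of_separates {S X : Type} [Fintype S] [Fintype X] {f : Encoder S X}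
    {q M N B₁ T₁ B₂ T₂ : ℕ} (hq : 2 ≤ q) (hMN : 0 < M + N) (hS : Fintype.card S = q ^ M)
    (hX : Fintype.card X = q ^ (M + N)) (h₁ : Separates f Set.univ B₁ T₁)
    (h₂ : Separates f Set.univ B₂ T₂) :
    (M : ℝ) / (M + N) ∈ achievableRates B₁ T₁ B₂ T₂ := by
  have : Nonempty S := Fintype.card_pos_iff.mp (by rw [hS]; positivity)
  refine ⟨S, X, inferInstance, inferInstance, PMF.uniformOfFintype S, f, ?_,
    serves_of_separates _ h₁, serves_of_separates _ h₂, ?_⟩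
  · rw [hX]
    exact hq.trans (Nat.le_self_pow hMN.ne' q)
  · have hlog2 : Real.log 2 ≠ 0 := (Real.log_pos (by norm_num)).ne'
    have hlogq : Real.log q ≠ 0 := (Real.log_pos (by exact_mod_cast hq)).ne'
    have hMN' : (M : ℝ) + N ≠ 0 := by exact_mod_cast hMN.ne'
    rw [entropyBits_uniformOfFintype, Real.logb, hS, hX]
    push_cast
    rw [Real.log_pow, Real.log_pow]
    push_cast
    field_simp

theorem mem_achievableRates_of_block {n N M b g B₁ T₁ B₂ T₂ : ℕ} (hn : 0 < n) (hN : 0 < N)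
    (hM : N ≤ M) (hb : 0 < b) (hg : 0 < g) (hB₁ : n * B₁ = N * b) (hB₂ : n * B₂ = N * (b + g))
    (hT₁ : M * b ≤ n * T₁) (hT₂ : (M + N) * b + M * g ≤ n * T₂) :
    (M : ℝ) / (M + N) ∈ achievableRates B₁ T₁ B₂ T₂ := by
  obtain ⟨q, hq, S, X, _, _, f, hS, hX, h₁, h₂⟩ := exists_separating_code hN hM hb hg
  rw [← hB₁] at h₁
  rw [← hB₂] at h₂
  exact mem_achievableRates_of_separates (q := q ^ n) (hq.trans (Nat.le_self_pow hn.ne' q))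
    (by omega) (by simp [hS, pow_right_comm]) (by simp [hX, pow_right_comm])
    (h₁.block hT₁) (h₂.block hT₂)

/-- Only the short-burst property of the code with `b = g = 1` is used. -/
theorem mem_achievableRates_of_le {B T B₁ T₁ B₂ T₂ : ℕ} (hB : 0 < B) (hBT : B ≤ T)
    (hB₁ : B₁ ≤ B) (hB₂ : B₂ ≤ B) (hT₁ : T ≤ T₁) (hT₂ : T ≤ T₂) :
    (T : ℝ) / (T + B) ∈ achievableRates B₁ T₁ B₂ T₂ := by
  obtain ⟨q, hq, S, X, _, _, f, hS, hX, h, -⟩ :=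
    exists_separating_code hB hBT one_pos one_pos
  rw [mul_one, mul_one] at h
  exact mem_achievableRates_of_separates hq (by omega) hS hX (h.mono hB₁ hT₁) (h.mono hB₂ hT₂)

theorem zero_mem_achievableRates (B₁ T₁ B₂ T₂ : ℕ) : (0 : ℝ) ∈ achievableRates B₁ T₁ B₂ T₂ := by
  have h : ∀ B T, Separates (fun _ _ => false : Encoder Unit Bool) Set.univ B T :=
    fun B T j t s s' _ _ _ => rfl
  refine ⟨Unit, Bool, inferInstance, inferInstance, PMF.pure (), fun _ _ => false, by simp,
    serves_of_separates _ (h _ _), serves_of_separates _ (h _ _), ?_⟩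
  simp [entropyBits]

theorem pair_rate_mem_upperBounds {B₁ T₁ B₂ W : ℕ} (hB₂ : 0 < B₂) (hB : B₁ ≤ B₂) (hT : T₁ ≤ W)
    {T₂ : ℕ} (hT₂ : T₂ ≤ W + B₁) :
    (W : ℝ) / (W + B₂) ∈ upperBounds (achievableRates B₁ T₁ B₂ T₂) := by
  rintro R ⟨S, X, _, _, p, f, hX, h₁, h₂, rfl⟩
  classical
  refine rate_le_of_log_le p hX (by positivity) ?_
  exact card_log_le_of_periodic f p.support p.support_nonempty B₂ W (W + B₁)
    (h₁.separates.eq_of_periodic_pair (h₂.separates.mono le_rfl hT₂) hB hT)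

end Streaming

/-! ### The four regimes -/

theorem theorem3 (B₁ T₁ B₂ T₂ : ℕ) (hB₁ : 0 < B₁) (hB : B₁ < B₂)
    (hlarge : B₂ ≤ T₁ ∨ B₁ + B₂ ≤ T₂) :
    (((B₂ : ℝ) / B₁) * T₁ + B₁ ≤ T₂ →
      Streaming.IsMulticastCapacity B₁ T₁ B₂ T₂ (Streaming.singleUserCapacity B₁ T₁)) ∧
    (T₁ + B₁ ≤ T₂ → (T₂ : ℝ) ≤ ((B₂ : ℝ) / B₁) * T₁ + B₁ →
      Streaming.IsMulticastCapacity B₁ T₁ B₂ T₂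
        (((T₂ : ℝ) - B₁) / ((T₂ : ℝ) - B₁ + B₂))) ∧
    (T₁ ≤ T₂ → T₂ ≤ T₁ + B₁ →
      Streaming.IsMulticastCapacity B₁ T₁ B₂ T₂ ((T₁ : ℝ) / (T₁ + B₂))) ∧
    (T₂ ≤ T₁ →
      Streaming.IsMulticastCapacity B₁ T₁ B₂ T₂ (Streaming.singleUserCapacity B₂ T₂)) := by
  obtain ⟨g, hg, rfl⟩ : ∃ g, 0 < g ∧ B₂ = B₁ + g := ⟨B₂ - B₁, by omega, by omega⟩
  have hB₁' : (0 : ℝ) < B₁ := by exact_mod_cast hB₁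
  have hα : ((B₁ + g : ℕ) : ℝ) / B₁ * T₁ + B₁ = (((B₁ + g) * T₁ + B₁ * B₁ : ℕ) : ℝ) / B₁ := by
    push_cast
    field_simp
  rw [hα, div_le_iff₀ hB₁', le_div_iff₀ hB₁']
  refine ⟨fun h => ⟨?_, ?_⟩, fun h h' => ?_, fun h h' => ⟨?_, ?_⟩, fun h => ⟨?_, ?_⟩⟩
  · unfold Streaming.singleUserCapacity
    split_ifs with hBT
    · have h' : (B₁ + g) * T₁ + B₁ * B₁ ≤ T₂ * B₁ := by exact_mod_cast h
      -- Take `N = B₁` and `M = T₁`: the second delay condition, divided by `B₁`, is `α * T₁ + B₁ ≤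
      -- T₂`.
      exact Streaming.mem_achievableRates_of_block (n := B₁) (b := B₁) (g := g) hB₁ hB₁ hBT hB₁ hg
        rfl rfl (mul_comm _ _).le (by linarith)
    · exact Streaming.zero_mem_achievableRates _ _ _ _
  · rintro R ⟨S, X, _, _, p, f, hX, h₁, -, rfl⟩
    exact Streaming.rate_le_singleUserCapacity hB₁ hX h₁
  · obtain ⟨W, rfl⟩ := Nat.exists_eq_add_of_le' (by omega : B₁ ≤ T₂)
    have hW : ((W + B₁ : ℕ) : ℝ) - B₁ = W := by push_cast; ring
    have h'' : (W + B₁) * B₁ ≤ (B₁ + g) * T₁ + B₁ * B₁ := by exact_mod_cast h'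
    rw [hW]
    refine ⟨?_, ?_⟩
    -- Take `N = B₂` and `M = W = T₂ - B₁`: the second delay condition is an equality, and the first
    -- is `T₂ ≤ α * T₁ + B₁`. Either alternative of `hlarge` gives `B₂ ≤ W`.
    · exact Streaming.mem_achievableRates_of_block (n := B₁ + g) (b := B₁) (g := g) (by omega)
        (by omega) (by omega) hB₁ hg rfl rfl (by linarith) (by linarith)
    · exact Streaming.pair_rate_mem_upperBounds (by omega) (by omega) (by omega) le_rfl
  -- Both alternatives of `hlarge` force `B₂ ≤ T₁` here, as `T₂ ≤ T₁ + B₁`.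
  · exact Streaming.mem_achievableRates_of_le (by omega) (by omega) (by omega) le_rfl le_rfl h
  · exact Streaming.pair_rate_mem_upperBounds (by omega) (by omega) le_rfl h'
  · unfold Streaming.singleUserCapacity
    split_ifs with hBT
    · exact Streaming.mem_achievableRates_of_le (by omega) hBT (by omega) le_rfl h le_rfl
    · exact Streaming.zero_mem_achievableRates _ _ _ _
  · rintro R ⟨S, X, _, _, p, f, hX, -, h₂, rfl⟩
    exact Streaming.rate_le_singleUserCapacity (by omega) hX h₂
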